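/- Let $\mathrm{Homeo}^+(\mathbb{R})$ be the set of increasing bijections $\mathbb{R}\to\mathbb{R}$. For a class $\Gamma$ of functions $\mathbb{R}\to\mathbb{R}$, a sparse $\Gamma$-system is a family $(f_P)_{P\in\mathbb{R}^2}$ of members of $\Gamma\cap\mathrm{Homeo}^+(\mathbb{R})$ such that $f_P(x_P)=y_P$ for every $P=(x_P,y_P)\in\mathbb{R}^2$ and such that, for every $u\in\mathbb{R}$, both sets $\{f_P(u) : P\in\mathbb{R}^2,\ u\neq x_P\}$ and $\{f_P^{-1}(u) : P\in\mathbb{R}^2,\ u\neq y_P\}$ are countable; $\Gamma$ carries a sparse system if a sparse $\Gamma$-system exists. For a sequence $\{M_k\}_{k\ge 0}$ of positive reals, $C_{\mathrm{loc}}\{M_k\}$ is the set of all $C^\infty$ functions $f:\mathbb{R}\to\mathbb{R}$ such that for every compact interval $K\subset\mathbb{R}$ there are $\beta,B>0$ with $\sup_{x\in K}|f^{(k)}(x)|\le \beta B^k M_k$ for all $k\ge 0$; a locally Denjoy–Carleman class is a class of this form. A class $\Gamma$ of $C^\infty$ functions is quasi-analytic if every $f\in\Gamma$ such that, for some $x_0$,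 $f^{(k)}(x_0)=0$ for all $k\ge 0$, is identically zero. Theorem. The locally Denjoy–Carleman class $C_{\mathrm{loc}}\{k!\}$ is quasi-analytic and is the class of real-analytic functions on $\mathbb{R}$, and the following are equivalent: (1) The Continuum Hypothesis holds, i.e. $2^{\aleph_0}=\aleph_1$. (2) Every locally Denjoy–Carleman class carries a sparse system. (3) At least one quasi-analytic locally Denjoy–Carleman class carries a sparse system. (4) $C_{\mathrm{loc}}\{k!\}$, i.e. the class of real-analytic functions on $\mathbb{R}$, carries a sparse system. -/

import Mathlib

/-- The Continuum Hypothesis, `2 ^ ℵ₀ = ℵ₁`. -/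
def ContinuumHypothesis : Prop :=
  Cardinal.continuum.{0} = Cardinal.aleph.{0} 1

/-- The class `C_loc {M_k}`: the smooth functions `f : ℝ → ℝ` such that on every compact interval
`[a, b]` there are positive `β`, `B` with `‖f^(k)‖ ≤ β * B ^ k * M k` for all `k`, the norm being
the supremum over `[a, b]`. As `f` is smooth on the whole line, its derivatives on `ℝ` agree on
`[a, b]`, `a < b`, with the (one-sided at the endpoints) derivatives of its restriction. -/
def CLoc (M : ℕ → ℝ) : Set (ℝ → ℝ) :=
  {f | ContDiff ℝ (⊤ : ℕ∞) f ∧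
    ∀ a b : ℝ, ∃ β B : ℝ, 0 < β ∧ 0 < B ∧
      ∀ k : ℕ, ∀ x ∈ Set.Icc a b, |iteratedDeriv k f x| ≤ β * B ^ k * M k}

/-- A locally Denjoy–Carleman class is a class of the form `C_loc {M_k}` for some sequence of
positive reals. -/
def IsLocallyDenjoyCarleman (Γ : Set (ℝ → ℝ)) : Prop :=
  ∃ M : ℕ → ℝ, (∀ k, 0 < M k) ∧ Γ = CLoc M

/-- A class of infinitely differentiable functions is quasi-analytic if its only member all of
whose derivatives (including the zeroth) vanish at some point is the zero function. -/
def IsQuasiAnalytic (Γ : Set (ℝ → ℝ)) : Prop :=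
  ∀ f ∈ Γ, (∃ x₀ : ℝ, ∀ k : ℕ, iteratedDeriv k f x₀ = 0) → ∀ x, f x = 0

/-- A family of increasing bijections of the real line, indexed by the points of the plane, is a
sparse `Γ`-system. -/
structure IsSparseSystem (Γ : Set (ℝ → ℝ)) (f : ℝ × ℝ → (ℝ ≃o ℝ)) : Prop where
  mem : ∀ P, (f P : ℝ → ℝ) ∈ Γ
  passes_through : ∀ P, f P P.1 = P.2
  countable_values : ∀ u : ℝ, {y : ℝ | ∃ P : ℝ × ℝ, u ≠ P.1 ∧ f P u = y}.Countable
  countable_inverse_values :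
    ∀ u : ℝ, {x : ℝ | ∃ P : ℝ × ℝ, u ≠ P.2 ∧ (f P).symm u = x}.Countable

/-- The class `Γ` carries a sparse system. -/
def CarriesSparseSystem (Γ : Set (ℝ → ℝ)) : Prop :=
  ∃ f : ℝ × ℝ → (ℝ ≃o ℝ), IsSparseSystem Γ f

/-! A sparse system in a quasi-analytic class forces CH: two distinct members agree only countably
often, since an uncountable agreement set accumulates and Rolle's theorem then kills every
derivative of the difference at the accumulation point (`IsQuasiAnalytic.countable_eqLocus`). If CH
failed, ℵ₁ members through points of the line x = 0 would have fewer than continuum many mutual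
agreement points, and at any other u ≠ 0 they would take ℵ₁ distinct values.

Conversely, CH attaches a countable set U P to each point P so that each u misses only countably
many of them. It then suffices to find, for each P and countable U, a member through P that sends
every other u ∈ U into u + ℚ, and likewise for its inverse (`exists_orderIso_mem_CLoc`). This is a
back-and-forth argument: start from g whose derivative dominates all polynomials, and add small
multiples of polynomials vanishing at the points already settled. The corrections are small enough
for their sum to stay in the class and to cost at most half of g'. -/

/-! ### Real-analytic functions and the class of k! -/

open Filter Topology in
theorem analyticAt_of_iteratedDeriv_bound {f : ℝ → ℝ} (hf : ContDiff ℝ (⊤ : ℕ∞) f) {x β B : ℝ}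
    (hB : 0 < B)
    (h : ∀ k : ℕ, ∀ t ∈ Set.Icc (x - 1) (x + 1), |iteratedDeriv k f t| ≤ β * B ^ k * k.factorial) :
    AnalyticAt ℝ f x := by
  set c : ℕ → ℝ := fun n ↦ iteratedDeriv n f x / n.factorial with hc
  -- The bound 1 keeps x + y where the estimate `h` holds; 1 / B makes β (B|y|)^(n+1), the bound for
  -- the Lagrange remainder, tend to zero.
  set r : ℝ := min 1 (1 / B) with hr
  have hr0 : 0 < r := by positivity
  have hcb (n : ℕ) : |c n| ≤ β * B ^ n := by
    rw [hc, abs_div, Nat.abs_cast, div_le_iff₀ (by positivity)]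
    exact h n x ⟨by linarith, by linarith⟩
  have hβ : 0 ≤ β := by simpa using (abs_nonneg _).trans (hcb 0)
  refine ⟨FormalMultilinearSeries.ofScalars ℝ c, ENNReal.ofReal r, ?_, by simpa using hr0, ?_⟩
  · refine FormalMultilinearSeries.le_radius_of_bound _ (r := r.toNNReal) β fun n ↦ ?_
    rw [FormalMultilinearSeries.ofScalars_norm, Real.norm_eq_abs, Real.coe_toNNReal _ hr0.le]
    have h1 : B * r ≤ 1 := by
      calc B * r ≤ B * (1 / B) := by gcongr; exact min_le_right _ _
        _ = 1 := by field_simp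
    calc |c n| * r ^ n ≤ β * B ^ n * r ^ n := by gcongr; exact hcb n
      _ = β * (B * r) ^ n := by rw [mul_pow]; ring
      _ ≤ β * 1 := by gcongr; exact pow_le_one₀ (by positivity) h1
      _ = β := mul_one β
  · intro y hy
    have hy : |y| < r := by
      rw [Metric.eball_ofReal] at hy
      simpa using hy
    have hq0 : 0 ≤ B * |y| := by positivity
    have hq1 : B * |y| < 1 := by
      calc B * |y| < B * r := by gcongr
        _ ≤ B * (1 / B) := by gcongr; exact min_le_right _ _
        _ = 1 := by field_simp
    have hy1 : |y| < 1 := hy.trans_le (min_le_left _ _)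
    simp only [FormalMultilinearSeries.ofScalars_apply_eq, smul_eq_mul]
    have hs : Summable fun n ↦ c n * y ^ n := by
      refine Summable.of_norm_bounded
        ((summable_geometric_of_lt_one hq0 hq1).mul_left β) fun n ↦ ?_
      rw [Real.norm_eq_abs, abs_mul, abs_pow]
      calc |c n| * |y| ^ n ≤ β * B ^ n * |y| ^ n := by gcongr; exact hcb n
        _ = β * (B * |y|) ^ n := by rw [mul_pow]; ring
    rcases eq_or_ne y 0 with rfl | hy0
    · have := hasSum_single (f := fun n ↦ c n * (0 : ℝ) ^ n) 0 (by intro b hb; simp [hb])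
      simpa [hc] using this
    rw [hs.hasSum_iff_tendsto_nat, ← tendsto_add_atTop_iff_nat 1]
    refine tendsto_iff_norm_sub_tendsto_zero.2 ?_
    refine squeeze_zero (g := fun n ↦ β * (B * |y|) ^ (n + 1)) (fun _ ↦ norm_nonneg _)
      (fun n ↦ ?_) ?_
    · have hne : x ≠ x + y := by simpa using hy0
      obtain ⟨t, ht, e⟩ := taylor_mean_remainder_lagrange_iteratedDeriv (n := n) hne
        ((hf.of_le (by exact_mod_cast le_top)).contDiffOn)
      have e2 : taylorWithinEval f n (Set.uIcc x (x + y)) x (x + y)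
          = ∑ i ∈ Finset.range (n + 1), c i * y ^ i := by
        rw [taylor_within_apply]
        refine Finset.sum_congr rfl fun i _ ↦ ?_
        rw [iteratedDerivWithin_eq_iteratedDeriv (uniqueDiffOn_uIcc hne)
          (hf.contDiffAt.of_le (by exact_mod_cast le_top)) Set.left_mem_uIcc]
        simp only [smul_eq_mul, hc, add_sub_cancel_left]
        ring
      rw [e2] at e
      have htI : t ∈ Set.Icc (x - 1) (x + 1) := by
        have := Set.uIoo_subset_uIcc_self ht
        rw [Set.mem_uIcc] at this
        have := abs_lt.1 hy1
        constructor <;> grind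
      rw [norm_sub_rev, e, add_sub_cancel_left, Real.norm_eq_abs, abs_div, abs_mul, abs_pow,
        Nat.abs_cast, div_le_iff₀ (by positivity)]
      calc |iteratedDeriv (n + 1) f t| * |y| ^ (n + 1)
          ≤ β * B ^ (n + 1) * (n + 1).factorial * |y| ^ (n + 1) := by
            gcongr; exact h _ t htI
        _ = β * (B * |y|) ^ (n + 1) * (n + 1).factorial := by rw [mul_pow]; ring
    · have := ((tendsto_pow_atTop_nhds_zero_of_lt_one hq0 hq1).const_mul β)
      rw [mul_zero] at this
      exact this.comp (tendsto_add_atTop_nat 1)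

/-- A real-analytic function extends near each point to a holomorphic function. -/
theorem AnalyticAt.exists_complex_extension {f : ℝ → ℝ} {x : ℝ} (hf : AnalyticAt ℝ f x) :
    ∃ r > 0, ∃ F : ℂ → ℂ, DifferentiableOn ℂ F (Metric.ball (x : ℂ) r) ∧
      ∀ t ∈ Metric.ball x r, F t = f t := by
  obtain ⟨p, R, hp⟩ := hf
  obtain ⟨r, hr0, hrR⟩ := ENNReal.lt_iff_exists_nnreal_btwn.1 hp.r_pos
  have hr0 : 0 < r := by simpa using hr0
  set q : FormalMultilinearSeries ℂ ℂ ℂ :=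
    FormalMultilinearSeries.ofScalars ℂ (fun n ↦ ((p.coeff n : ℝ) : ℂ)) with hq
  have hqr : (r : ENNReal) ≤ q.radius := by
    obtain ⟨C, -, hC⟩ := p.norm_mul_pow_le_of_lt_radius (hrR.trans_le hp.r_le)
    refine q.le_radius_of_bound C fun n ↦ ?_
    rw [hq, FormalMultilinearSeries.ofScalars_norm, Complex.norm_real]
    simpa [FormalMultilinearSeries.norm_apply_eq_norm_coef] using hC n
  have hqp : 0 < q.radius := lt_of_lt_of_le (by simpa using hr0) hqr
  have hF := (q.hasFPowerSeriesOnBall hqp).comp_sub (x : ℂ)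
  rw [zero_add] at hF
  have hsub : Metric.ball (x : ℂ) r ⊆ Metric.eball (x : ℂ) q.radius := by
    rw [← Metric.eball_coe]
    exact Metric.eball_subset_eball hqr
  refine ⟨r, by exact_mod_cast hr0, fun z ↦ q.sum (z - x),
    hF.analyticOnNhd.differentiableOn.mono hsub, fun t ht ↦ ?_⟩
  have h1 : t - x ∈ Metric.eball (0 : ℝ) R := by
    refine Metric.eball_subset_eball hrR.le ?_
    rw [Metric.eball_coe]
    simpa [Real.dist_eq] using ht
  have h2 := hp.hasSum h1
  rw [add_sub_cancel] at h2
  rw [← h2.tsum_eq, Complex.ofReal_tsum]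
  refine tsum_congr fun n ↦ ?_
  rw [hq, FormalMultilinearSeries.ofScalars_apply_eq, p.apply_eq_pow_smul_coeff]
  simp [mul_comm]

theorem iteratedDeriv_ofReal_eq {f : ℝ → ℝ} (hf : ContDiff ℝ (⊤ : ℕ∞) f) {F : ℂ → ℂ} {x r : ℝ}
    (hF : DifferentiableOn ℂ F (Metric.ball (x : ℂ) r)) (hFf : ∀ t ∈ Metric.ball x r, F t = f t)
    (k : ℕ) : ∀ t ∈ Metric.ball x r, iteratedDeriv k F t = iteratedDeriv k f t := by
  induction k with
  | zero => simpa using hFf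
  | succ k ih =>
    intro t ht
    have htC : (t : ℂ) ∈ Metric.ball (x : ℂ) r := by
      simpa [Complex.dist_eq, ← Complex.ofReal_sub, Real.dist_eq] using ht
    have hA : AnalyticAt ℂ (iteratedDeriv k F) t := by
      rw [iteratedDeriv_eq_iterate]
      exact ((hF.analyticOnNhd Metric.isOpen_ball).iterated_deriv k) t htC
    have h1 : HasDerivAt (fun s : ℝ ↦ iteratedDeriv k F s) (iteratedDeriv (k + 1) F t) t := by
      rw [iteratedDeriv_succ]
      exact hA.differentiableAt.hasDerivAt.comp_ofReal
    have h2 : HasDerivAt (fun s : ℝ ↦ ((iteratedDeriv k f s : ℝ) : ℂ))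
        ((iteratedDeriv (k + 1) f t : ℝ) : ℂ) t := by
      rw [iteratedDeriv_succ]
      exact (hf.differentiable_iteratedDeriv k (by exact_mod_cast WithTop.coe_lt_top k)
        t).hasDerivAt.ofReal_comp
    refine h1.unique (h2.congr_of_eventuallyEq ?_)
    filter_upwards [Metric.isOpen_ball.mem_nhds ht] with s hs using ih s hs

/-- Cauchy's estimates for the holomorphic extension: discs of radius r/4 about points within r/4 of
x stay in the closed disc of radius r/2, where the extension is bounded. -/
theorem exists_local_iteratedDeriv_bound {f : ℝ → ℝ} (hf : ContDiff ℝ (⊤ : ℕ∞) f) {x : ℝ}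
    (hx : AnalyticAt ℝ f x) :
    ∃ δ > 0, ∃ β B : ℝ, 0 < β ∧ 0 < B ∧ ∀ t ∈ Metric.ball x δ, ∀ k : ℕ,
      |iteratedDeriv k f t| ≤ β * B ^ k * k.factorial := by
  obtain ⟨r, hr, F, hF, hFf⟩ := hx.exists_complex_extension
  obtain ⟨C, hC⟩ := (isCompact_closedBall (x : ℂ) (r / 2)).exists_bound_of_continuousOn
    (hF.continuousOn.mono (Metric.closedBall_subset_ball (half_lt_self hr)))
  have hC0 : 0 ≤ C := (norm_nonneg _).trans (hC x (Metric.mem_closedBall_self (by positivity)))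
  refine ⟨r / 4, by positivity, C + 1, 4 / r, by positivity, by positivity, fun t ht k ↦ ?_⟩
  have htx : |t - x| < r / 4 := by simpa [Real.dist_eq] using ht
  have ht' : t ∈ Metric.ball x r := Metric.ball_subset_ball (by linarith) ht
  have hdist : dist (t : ℂ) x = |t - x| := by
    rw [Complex.dist_eq, ← Complex.ofReal_sub, Complex.norm_real, Real.norm_eq_abs]
  have hcb : Metric.closedBall (t : ℂ) (r / 4) ⊆ Metric.closedBall (x : ℂ) (r / 2) :=
    Metric.closedBall_subset_closedBall' (by rw [hdist]; linarith)
  have hd : DiffContOnCl ℂ F (Metric.ball (t : ℂ) (r / 4)) := by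
    refine DifferentiableOn.diffContOnCl ?_
    rw [closure_ball _ (by positivity)]
    exact hF.mono (hcb.trans (Metric.closedBall_subset_ball (half_lt_self hr)))
  have := Complex.norm_iteratedDeriv_le_of_forall_mem_sphere_norm_le k (C := C)
    (by positivity : 0 < r / 4) hd fun z hz ↦ hC z (hcb (Metric.sphere_subset_closedBall hz))
  rw [iteratedDeriv_ofReal_eq hf hF hFf k t ht', Complex.norm_real, Real.norm_eq_abs] at this
  refine this.trans ?_
  have e : k.factorial * C / (r / 4) ^ k = C * (4 / r) ^ k * k.factorial := by
    rw [div_pow, div_pow]; field_simp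
  rw [e]
  gcongr
  linarith

theorem CLoc_factorial_eq :
    CLoc (fun k => (Nat.factorial k : ℝ)) = {f : ℝ → ℝ | AnalyticOnNhd ℝ f Set.univ} := by
  ext f
  constructor
  · rintro ⟨hf, h⟩ x -
    obtain ⟨β, B, -, hB, hb⟩ := h (x - 1) (x + 1)
    exact analyticAt_of_iteratedDeriv_bound hf hB hb
  · intro hf
    have hs : ContDiff ℝ (⊤ : ℕ∞) f := hf.contDiff
    refine ⟨hs, fun a b ↦ ?_⟩
    suffices ∃ β B : ℝ, 0 < β ∧ 0 < B ∧ ∀ x ∈ Set.Icc a b, ∀ k : ℕ,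
        |iteratedDeriv k f x| ≤ β * B ^ k * k.factorial by
      obtain ⟨β, B, h1, h2, h3⟩ := this
      exact ⟨β, B, h1, h2, fun k x hx ↦ h3 x hx k⟩
    -- Local bounds merge over a finite cover by taking the maxima of β and of B.
    refine (isCompact_Icc (a := a) (b := b)).induction_on (p := fun s ↦ ∃ β B : ℝ, 0 < β ∧ 0 < B ∧
      ∀ x ∈ s, ∀ k : ℕ, |iteratedDeriv k f x| ≤ β * B ^ k * k.factorial)
      ⟨1, 1, by simp⟩ ?_ ?_ ?_
    · rintro s t hst ⟨β, B, h1, h2, h3⟩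
      exact ⟨β, B, h1, h2, fun x hx ↦ h3 x (hst hx)⟩
    · rintro s t ⟨β, B, h1, h2, h3⟩ ⟨β', B', h1', h2', h3'⟩
      refine ⟨max β β', max B B', by positivity, by positivity, ?_⟩
      rintro x (hx | hx) k
      · refine (h3 x hx k).trans ?_
        gcongr <;> exact le_max_left _ _
      · refine (h3' x hx k).trans ?_
        gcongr <;> exact le_max_right _ _
    · intro x _
      obtain ⟨δ, hδ, β, B, h1, h2, h3⟩ := exists_local_iteratedDeriv_bound hs (hf x trivial)
      exact ⟨_, mem_nhdsWithin_of_mem_nhds (Metric.ball_mem_nhds x hδ), β, B, h1, h2, h3⟩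

theorem isQuasiAnalytic_CLoc_factorial :
    IsQuasiAnalytic (CLoc (fun k => (Nat.factorial k : ℝ))) := by
  rw [CLoc_factorial_eq]
  rintro f hf ⟨x₀, h⟩ x
  have h1 := (hf x₀ trivial).hasFPowerSeriesAt
  have h2 : (FormalMultilinearSeries.ofScalars ℝ
      (fun n ↦ iteratedDeriv n f x₀ / n.factorial)) = 0 := by
    rw [FormalMultilinearSeries.ofScalars_series_eq_zero]
    ext n
    simp [h n]
  rw [h2] at h1
  exact AnalyticOnNhd.eqOn_zero_of_preconnected_of_eventuallyEq_zero hf isPreconnected_univ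
    trivial h1.eventually_eq_zero trivial

/-! ### Agreement sets in quasi-analytic classes, and the necessity of CH -/

theorem CLoc.sub {M : ℕ → ℝ} (hM : ∀ k, 0 < M k) {f g : ℝ → ℝ} (hf : f ∈ CLoc M)
    (hg : g ∈ CLoc M) : f - g ∈ CLoc M := by
  refine ⟨hf.1.sub hg.1, fun a b ↦ ?_⟩
  obtain ⟨β, B, h1, h2, h3⟩ := hf.2 a b
  obtain ⟨β', B', h1', h2', h3'⟩ := hg.2 a b
  refine ⟨β + β', max B B', by positivity, by positivity, fun k x hx ↦ ?_⟩
  rw [iteratedDeriv_sub (hf.1.contDiffAt.of_le (by exact_mod_cast le_top))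
    (hg.1.contDiffAt.of_le (by exact_mod_cast le_top))]
  have := (hM k).le
  calc |iteratedDeriv k f x - iteratedDeriv k g x|
      ≤ |iteratedDeriv k f x| + |iteratedDeriv k g x| := abs_sub _ _
    _ ≤ β * B ^ k * M k + β' * B' ^ k * M k := add_le_add (h3 k x hx) (h3' k x hx)
    _ ≤ β * (max B B') ^ k * M k + β' * (max B B') ^ k * M k := by
      gcongr
      · exact le_max_left _ _
      · exact le_max_right _ _
    _ = (β + β') * (max B B') ^ k * M k := by ring

open Filter Topology in
/-- An accumulation point of zeros is an accumulation point of zeros of the derivative. -/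
theorem frequently_deriv_eq_zero {f : ℝ → ℝ} (hf : Differentiable ℝ f) {x : ℝ}
    (h : ∃ᶠ t in 𝓝[≠] x, f t = 0) : ∃ᶠ t in 𝓝[≠] x, deriv f t = 0 := by
  have hx : f x = 0 := by
    have hc : IsClosed {t | f t = 0} := isClosed_eq hf.continuous continuous_const
    exact hc.mem_of_frequently_of_tendsto h (tendsto_id.mono_left nhdsWithin_le_nhds)
  rw [frequently_iff] at h ⊢
  intro U hU
  obtain ⟨ε, hε, hεU⟩ := Metric.mem_nhdsWithin_iff.1 hU
  obtain ⟨t, ⟨htε, htx⟩, ht⟩ := h (inter_mem (mem_nhdsWithin_of_mem_nhds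
    (Metric.ball_mem_nhds x hε)) self_mem_nhdsWithin)
  have htx : t ≠ x := htx
  rw [Metric.mem_ball, Real.dist_eq] at htε
  have htε := abs_lt.1 htε
  rcases htx.lt_or_gt with hlt | hlt
  · obtain ⟨c, hc, hc'⟩ := exists_deriv_eq_zero hlt hf.continuous.continuousOn (ht.trans hx.symm)
    refine ⟨c, hεU ⟨?_, hc.2.ne⟩, hc'⟩
    rw [Metric.mem_ball, Real.dist_eq, abs_lt]
    constructor <;> linarith [hc.1, hc.2]
  · obtain ⟨c, hc, hc'⟩ := exists_deriv_eq_zero hlt hf.continuous.continuousOn (hx.trans ht.symm)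
    refine ⟨c, hεU ⟨?_, hc.1.ne'⟩, hc'⟩
    rw [Metric.mem_ball, Real.dist_eq, abs_lt]
    constructor <;> linarith [hc.1, hc.2]

open Filter Topology in
theorem iteratedDeriv_eq_zero_of_frequently {f : ℝ → ℝ} (hf : ContDiff ℝ (⊤ : ℕ∞) f) {x : ℝ}
    (h : ∃ᶠ t in 𝓝[≠] x, f t = 0) (k : ℕ) : iteratedDeriv k f x = 0 := by
  have hd (k : ℕ) : Differentiable ℝ (iteratedDeriv k f) :=
    hf.differentiable_iteratedDeriv k (by exact_mod_cast WithTop.coe_lt_top k)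
  have hk : ∃ᶠ t in 𝓝[≠] x, iteratedDeriv k f t = 0 := by
    induction k with
    | zero => simpa using h
    | succ k ih => rw [iteratedDeriv_succ]; exact frequently_deriv_eq_zero (hd k) ih
  have hc : IsClosed {t | iteratedDeriv k f t = 0} :=
    isClosed_eq (hd k).continuous continuous_const
  exact hc.mem_of_frequently_of_tendsto hk (tendsto_id.mono_left nhdsWithin_le_nhds)

open Filter Topology in
/-- An uncountable set of reals accumulates at one of its points. -/
theorem exists_frequently_mem_of_not_countable {Z : Set ℝ} (hZ : ¬ Z.Countable) :
    ∃ x, ∃ᶠ t in 𝓝[≠] x, t ∈ Z := by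
  by_contra! h
  refine hZ ?_
  -- Without accumulation points Z is a discrete subspace of ℝ, and separability makes it countable.
  have hd : DiscreteTopology Z := by
    rw [discreteTopology_subtype_iff]
    intro x _
    rw [← Filter.empty_mem_iff_bot]
    have h1 : Zᶜ ∈ 𝓝[≠] x := h x
    simpa using Filter.inter_mem (Filter.mem_inf_of_left (g := 𝓟 Z) h1)
      (Filter.mem_inf_of_right (f := 𝓝[≠] x) (Filter.mem_principal_self Z))
  exact Set.countable_coe_iff.1 (TopologicalSpace.separableSpace_iff_countable.1 inferInstance)

theorem IsQuasiAnalytic.countable_eqLocus {M : ℕ → ℝ} (hM : ∀ k, 0 < M k)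
    (hq : IsQuasiAnalytic (CLoc M)) {f g : ℝ → ℝ} (hf : f ∈ CLoc M) (hg : g ∈ CLoc M)
    (hne : f ≠ g) : {u | f u = g u}.Countable := by
  by_contra hc
  obtain ⟨x, hx⟩ := exists_frequently_mem_of_not_countable hc
  have hs := CLoc.sub hM hf hg
  refine hne (funext fun u ↦ sub_eq_zero.1 (hq _ hs ⟨x, fun k ↦ ?_⟩ u))
  exact iteratedDeriv_eq_zero_of_frequently hs.1 (hx.mono fun t ht ↦ sub_eq_zero.2 ht) k

open Cardinal in
theorem continuumHypothesis_of_carriesSparseSystem {M : ℕ → ℝ} (hM : ∀ k, 0 < M k)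
    (hq : IsQuasiAnalytic (CLoc M)) (hs : CarriesSparseSystem (CLoc M)) :
    ContinuumHypothesis := by
  obtain ⟨f, hf⟩ := hs
  by_contra hCH
  have hlt : aleph 1 < continuum.{0} := lt_of_le_of_ne aleph_one_le_continuum (Ne.symm hCH)
  obtain ⟨S, hS⟩ : ∃ S : Set ℝ, #S = aleph 1 := by
    rw [← le_mk_iff_exists_set, mk_real]; exact hlt.le
  have hne (y y' : ℝ) (h : y ≠ y') : (f (0, y) : ℝ → ℝ) ≠ f (0, y') := fun e ↦ h <| by
    have h1 : f (0, y) 0 = y := hf.passes_through (0, y)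
    have h2 : f (0, y') 0 = y' := hf.passes_through (0, y')
    exact h1.symm.trans ((congrFun e 0).trans h2)
  -- Including 0 ensures that u ∉ T differs from the abscissa of every chosen point (0, y).
  set T : Set ℝ := (⋃ p : {p : S × S // p.1 ≠ p.2},
    {u | f (0, p.1.1) u = f (0, p.1.2) u}) ∪ {0} with hT
  have hTc : #T < continuum.{0} := by
    have hc1 : #(⋃ p : {p : S × S // p.1 ≠ p.2}, {u | f (0, p.1.1) u = f (0, p.1.2) u} : Set ℝ)
        ≤ aleph 1 := by
      refine (mk_iUnion_le _).trans ?_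
      refine (mul_le_mul' (b := aleph 1) (d := aleph 1) ?_ (ciSup_le' fun p ↦ ?_)).trans
        (mul_eq_self (aleph0_le_aleph 1)).le
      · refine (mk_subtype_le _).trans ?_
        rw [mk_prod, hS]
        simp
      · refine (Set.Countable.le_aleph0 ?_).trans (aleph0_le_aleph 1)
        exact hq.countable_eqLocus hM (hf.mem _) (hf.mem _)
          (hne _ _ fun e ↦ p.2 (Subtype.ext e))
    refine (mk_union_le _ _).trans_lt (add_lt_of_lt aleph0_le_continuum (hc1.trans_lt hlt) ?_)
    simpa using nat_lt_continuum 1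
  obtain ⟨u, hu⟩ : ∃ u, u ∉ T := by
    by_contra! h
    rw [Set.eq_univ_of_forall h, mk_univ, mk_real] at hTc
    exact lt_irrefl _ hTc
  rw [hT, Set.mem_union, not_or, Set.mem_iUnion] at hu
  have hcount := hf.countable_values u
  have hinj : Set.InjOn (fun y ↦ f (0, y) u) S := by
    intro y hy y' hy' e
    by_contra hyy
    exact hu.1 ⟨⟨(⟨y, hy⟩, ⟨y', hy'⟩), fun e ↦ hyy (congrArg Subtype.val e)⟩, e⟩
  have hSc : S.Countable := by
    refine Set.MapsTo.countable_of_injOn (t := {y : ℝ | ∃ P : ℝ × ℝ, u ≠ P.1 ∧ f P u = y})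
      (fun y _ ↦ ⟨(0, y), fun e ↦ hu.2 e, rfl⟩) hinj hcount
  have := hSc.le_aleph0
  rw [hS] at this
  exact absurd this (not_le.2 aleph0_lt_aleph_one)

/-! ### Series of tiny polynomials and a dominating function -/

open Polynomial

/-- Only finitely many derivatives of a polynomial are nonzero, so one constant serves all k
whatever the growth of M. -/
theorem Polynomial.exists_iterate_derivative_bound {M : ℕ → ℝ} (hM : ∀ k, 0 < M k) (p : ℝ[X])
    (R : ℝ) :
    ∃ C > 0, ∀ (k : ℕ) (t : ℝ), |t| ≤ R → |(derivative^[k] p).eval t| ≤ C * M k := by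
  have h (k : ℕ) : ∃ C, ∀ t ∈ Set.Icc (-R) R, ‖(derivative^[k] p).eval t‖ ≤ C :=
    isCompact_Icc.exists_bound_of_continuousOn (derivative^[k] p).continuous.continuousOn
  choose C hC using h
  have hC0 (k : ℕ) : 0 ≤ max (C k) 0 / M k := div_nonneg (le_max_right _ _) (hM k).le
  have hs : 0 ≤ ∑ k ∈ Finset.range (p.natDegree + 1), max (C k) 0 / M k :=
    Finset.sum_nonneg fun k _ ↦ hC0 k
  refine ⟨∑ k ∈ Finset.range (p.natDegree + 1), max (C k) 0 / M k + 1, by positivity,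
    fun k t ht ↦ ?_⟩
  rcases lt_or_ge p.natDegree k with hk | hk
  · rw [iterate_derivative_eq_zero hk, eval_zero, abs_zero]
    have := hM k
    positivity
  · have h1 : max (C k) 0 / M k ≤ ∑ k ∈ Finset.range (p.natDegree + 1), max (C k) 0 / M k :=
      Finset.single_le_sum (f := fun k ↦ max (C k) 0 / M k) (fun k _ ↦ hC0 k)
        (Finset.mem_range.2 (by omega))
    calc |(derivative^[k] p).eval t| ≤ max (C k) 0 :=
          (hC k t (Set.mem_Icc.2 (abs_le.1 ht))).trans (le_max_left _ _)
      _ = max (C k) 0 / M k * M k := by rw [div_mul_cancel₀ _ (hM k).ne']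
      _ ≤ _ := by
        have := (hM k).le
        gcongr
        linarith

/-- A polynomial whose derivatives on `[-n, n]` are bounded by `2⁻ⁿ M k`. -/
def Polynomial.IsTiny (M : ℕ → ℝ) (n : ℕ) (q : ℝ[X]) : Prop :=
  ∀ (k : ℕ) (t : ℝ), |t| ≤ n → |(derivative^[k] q).eval t| ≤ (1 / 2) ^ n * M k

theorem Polynomial.exists_isTiny {M : ℕ → ℝ} (hM : ∀ k, 0 < M k) (n : ℕ) (q : ℝ[X]) :
    ∃ ε > 0, ∀ l, |l| ≤ ε → (C l * q).IsTiny M n := by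
  obtain ⟨K, hK, h⟩ := q.exists_iterate_derivative_bound hM n
  refine ⟨(1 / 2) ^ n / K, by positivity, fun l hl k t ht ↦ ?_⟩
  rw [iterate_derivative_C_mul, eval_mul, eval_C, abs_mul]
  calc |l| * |(derivative^[k] q).eval t| ≤ (1 / 2) ^ n / K * (K * M k) := by
        gcongr
        exact h k t ht
    _ = _ := by field_simp

section TinySeries

variable {M : ℕ → ℝ} {q : ℕ → ℝ[X]}

/-- On [-R, R] tininess applies as soon as n ≥ R; the finitely many earlier terms are absorbed by
constants of their own. -/
theorem exists_summable_bound (hM : ∀ k, 0 < M k) (hq : ∀ n, (q n).IsTiny M n) (R : ℕ) :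
    ∃ u : ℕ → ℝ, Summable u ∧ (∀ n, 0 ≤ u n) ∧
      ∀ (n k : ℕ) (t : ℝ), |t| ≤ R → |(derivative^[k] (q n)).eval t| ≤ u n * M k := by
  choose K hK h using fun n ↦ (q n).exists_iterate_derivative_bound hM R
  refine ⟨fun n ↦ (1 / 2) ^ n + if n < R then K n else 0, ?_, fun n ↦ ?_, fun n k t ht ↦ ?_⟩
  · refine summable_geometric_two.add (summable_of_ne_finset_zero (s := Finset.range R) ?_)
    intro n hn
    rw [if_neg (by simpa using hn)]
  · have := (hK n).le
    positivity
  · have := (hM k).le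
    beta_reduce
    split_ifs with hn
    · refine (h n k t ht).trans ?_
      gcongr
      have : (0 : ℝ) ≤ (1 / 2) ^ n := by positivity
      linarith
    · rw [add_zero]
      exact hq n k t (ht.trans (by exact_mod_cast not_lt.1 hn))

theorem summable_eval_iterate_derivative (hM : ∀ k, 0 < M k) (hq : ∀ n, (q n).IsTiny M n)
    (k : ℕ) (t : ℝ) : Summable fun n ↦ (derivative^[k] (q n)).eval t := by
  obtain ⟨R, hR⟩ := exists_nat_ge |t|
  obtain ⟨u, hu, -, h⟩ := exists_summable_bound hM hq R
  exact Summable.of_norm_bounded (hu.mul_right (M k)) fun n ↦ h n k t hR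

theorem hasDerivAt_tsum_eval (hM : ∀ k, 0 < M k) (hq : ∀ n, (q n).IsTiny M n) (k : ℕ) (t : ℝ) :
    HasDerivAt (fun s ↦ ∑' n, (derivative^[k] (q n)).eval s)
      (∑' n, (derivative^[k + 1] (q n)).eval t) t := by
  obtain ⟨R, hR⟩ := exists_nat_gt |t|
  obtain ⟨u, hu, -, h⟩ := exists_summable_bound hM hq R
  have ht : t ∈ Metric.ball (0 : ℝ) R := by simpa using hR
  refine hasDerivAt_tsum_of_isPreconnected (g := fun n s ↦ (derivative^[k] (q n)).eval s)
    (g' := fun n s ↦ (derivative^[k + 1] (q n)).eval s) (hu.mul_right (M (k + 1))) Metric.isOpen_ball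
    (convex_ball _ _).isPreconnected (fun n s _ ↦ ?_) (fun n s hs ↦ ?_) ht
    (summable_eval_iterate_derivative hM hq k t) ht
  · simp only [Function.iterate_succ_apply']
    exact (derivative^[k] (q n)).hasDerivAt s
  · exact h n (k + 1) s (by simpa using (Metric.mem_ball.1 hs).le)

theorem iteratedDeriv_tsum_eval (hM : ∀ k, 0 < M k) (hq : ∀ n, (q n).IsTiny M n) (k : ℕ) :
    iteratedDeriv k (fun s ↦ ∑' n, (q n).eval s) = fun s ↦ ∑' n, (derivative^[k] (q n)).eval s := by
  induction k with
  | zero => simp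
  | succ k ih =>
    rw [iteratedDeriv_succ, ih]
    exact funext fun t ↦ (hasDerivAt_tsum_eval hM hq k t).deriv

theorem tsum_eval_mem_CLoc (hM : ∀ k, 0 < M k) (hq : ∀ n, (q n).IsTiny M n) :
    (fun s ↦ ∑' n, (q n).eval s) ∈ CLoc M := by
  refine ⟨contDiff_of_differentiable_iteratedDeriv fun k _ ↦ ?_, fun a b ↦ ?_⟩
  · rw [iteratedDeriv_tsum_eval hM hq]
    exact fun t ↦ (hasDerivAt_tsum_eval hM hq k t).differentiableAt
  · obtain ⟨R, hR⟩ := exists_nat_ge (max |a| |b|)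
    obtain ⟨u, hu, hu0, h⟩ := exists_summable_bound hM hq R
    have hs : 0 ≤ ∑' n, u n := tsum_nonneg hu0
    refine ⟨∑' n, u n + 1, 1, by positivity, one_pos, fun k t ht ↦ ?_⟩
    have htR : |t| ≤ R := (abs_le_max_abs_abs ht.1 ht.2).trans hR
    rw [iteratedDeriv_tsum_eval hM hq]
    have := tsum_of_norm_bounded (f := fun n ↦ (derivative^[k] (q n)).eval t) (hu.hasSum.mul_right (M k)) fun n ↦ h n k t htR
    rw [Real.norm_eq_abs] at this
    have := (hM k).le
    rw [one_pow, mul_one]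
    nlinarith

end TinySeries

theorem Polynomial.iteratedDeriv_eval (p : ℝ[X]) (k : ℕ) :
    iteratedDeriv k (fun t ↦ p.eval t) = fun t ↦ (derivative^[k] p).eval t := by
  induction k with
  | zero => simp
  | succ k ih =>
    ext t
    rw [iteratedDeriv_succ, ih, Polynomial.deriv, Function.iterate_succ_apply']

theorem Polynomial.eval_mem_CLoc {M : ℕ → ℝ} (hM : ∀ k, 0 < M k) (p : ℝ[X]) :
    (fun t ↦ p.eval t) ∈ CLoc M := by
  refine ⟨contDiff_of_differentiable_iteratedDeriv fun k _ ↦ ?_, fun a b ↦ ?_⟩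
  · rw [p.iteratedDeriv_eval]
    exact Polynomial.differentiable _
  obtain ⟨K, hK, h⟩ := p.exists_iterate_derivative_bound hM (max |a| |b|)
  refine ⟨K, 1, hK, one_pos, fun k t ht ↦ ?_⟩
  rw [p.iteratedDeriv_eval, one_pow, mul_one]
  exact h k t (abs_le_max_abs_abs ht.1 ht.2)

theorem CLoc.add {M : ℕ → ℝ} (hM : ∀ k, 0 < M k) {f g : ℝ → ℝ} (hf : f ∈ CLoc M)
    (hg : g ∈ CLoc M) : f + g ∈ CLoc M := by
  have h0 : (0 : ℝ → ℝ) ∈ CLoc M := by simpa [Pi.zero_def] using eval_mem_CLoc hM 0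
  simpa using CLoc.sub hM hf (CLoc.sub hM h0 hg)

/-- Every class `C_loc {M_k}` has a member whose derivative is bounded below by a positive constant
and dominates every polynomial. -/
theorem exists_mem_CLoc_dominating {M : ℕ → ℝ} (hM : ∀ k, 0 < M k) :
    ∃ g ∈ CLoc M, ∃ g' : ℝ → ℝ, (∀ t, HasDerivAt g (g' t) t) ∧ (∃ c > 0, ∀ t, c ≤ g' t) ∧
      ∀ p : ℝ[X], ∃ K > 0, ∀ t, |p.eval t| ≤ K * g' t := by
  -- Odd powers with positive coefficients: the derivative is a series of nonnegative even powers,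
  -- hence at least each of its terms, and even powers control all monomials.
  choose c hc h using fun n : ℕ ↦ exists_isTiny hM n (X ^ (2 * n + 1) : ℝ[X])
  have hq (n : ℕ) : (C (c n) * X ^ (2 * n + 1) : ℝ[X]).IsTiny M n :=
    h n (c n) (abs_of_pos (hc n)).le
  have he (n : ℕ) (t : ℝ) : (derivative^[1] (C (c n) * X ^ (2 * n + 1) : ℝ[X])).eval t
      = c n * (2 * n + 1) * t ^ (2 * n) := by
    simp; ring
  set g' : ℝ → ℝ := fun t ↦ ∑' n, (derivative^[1] (C (c n) * X ^ (2 * n + 1) : ℝ[X])).eval t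
    with hg'
  have hle (n : ℕ) (t : ℝ) : c n * (2 * n + 1) * t ^ (2 * n) ≤ g' t := by
    rw [← he n t]
    refine (summable_eval_iterate_derivative hM hq 1 t).le_tsum n fun m _ ↦ ?_
    rw [he m t, pow_mul]
    have := hc m
    positivity
  have hc0 (t : ℝ) : c 0 ≤ g' t := by simpa using hle 0 t
  refine ⟨_, tsum_eval_mem_CLoc hM hq, g', fun t ↦ ?_, ⟨c 0, hc 0, hc0⟩, fun p ↦ ?_⟩
  · exact hasDerivAt_tsum_eval hM hq 0 t
  · induction p using Polynomial.induction_on' with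
    | add p q hp hq =>
      obtain ⟨K, hK, h1⟩ := hp
      obtain ⟨L, hL, h2⟩ := hq
      refine ⟨K + L, by positivity, fun t ↦ ?_⟩
      rw [eval_add, add_mul]
      exact (abs_add_le _ _).trans (add_le_add (h1 t) (h2 t))
    | monomial n a =>
      have hcn := hc n
      have hc0' := hc 0
      refine ⟨(|a| + 1) * (1 / c 0 + 1 / (c n * (2 * n + 1))), by positivity, fun t ↦ ?_⟩
      rw [eval_monomial, abs_mul, abs_pow, mul_assoc]
      have h1 : |t| ^ n ≤ 1 + t ^ (2 * n) := by
        rw [pow_mul, ← sq_abs, ← pow_mul, mul_comm 2 n, pow_mul]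
        nlinarith [sq_nonneg (|t| ^ n - 1)]
      have h2 : 1 ≤ 1 / c 0 * g' t := by
        rw [one_div, ← div_eq_inv_mul, one_le_div (hc 0)]; exact hc0 t
      have h3 : t ^ (2 * n) ≤ 1 / (c n * (2 * n + 1)) * g' t := by
        rw [one_div, ← div_eq_inv_mul, le_div_iff₀ (by positivity), mul_comm]; exact hle n t
      refine mul_le_mul (by linarith) ?_ (by positivity) (by positivity)
      linarith

/-- Since f t - c t is monotone, f lies beyond a line of slope c on either side of 0 and so is
unbounded in both directions. -/
theorem strictMono_surjective_of_deriv_ge {f f' : ℝ → ℝ} {c : ℝ} (hc : 0 < c)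
    (hf : ∀ t, HasDerivAt f (f' t) t) (h : ∀ t, c ≤ f' t) :
    StrictMono f ∧ Function.Surjective f := by
  have hcont : Continuous f := continuous_iff_continuousAt.2 fun t ↦ (hf t).continuousAt
  refine ⟨strictMono_of_hasDerivAt_pos hf fun t ↦ hc.trans_le (h t), ?_⟩
  have hd (t : ℝ) : HasDerivAt (fun s ↦ f s - c * s) (f' t - c) t := by
    simpa using (hf t).fun_sub ((hasDerivAt_id t).const_mul c)
  have hm : Monotone fun s ↦ f s - c * s :=
    monotone_of_deriv_nonneg (fun t ↦ (hd t).differentiableAt) fun t ↦ by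
      rw [(hd t).deriv]; linarith [h t]
  have hlin : Filter.Tendsto (fun t : ℝ ↦ f 0 + c * t) Filter.atTop Filter.atTop :=
    Filter.tendsto_atTop_add_const_left _ _ (Filter.tendsto_id.const_mul_atTop hc)
  have hlin' : Filter.Tendsto (fun t : ℝ ↦ f 0 + c * t) Filter.atBot Filter.atBot :=
    Filter.tendsto_atBot_add_const_left _ _ (Filter.tendsto_id.const_mul_atBot hc)
  refine hcont.surjective (Filter.tendsto_atTop_mono' _ ?_ hlin)
    (Filter.tendsto_atBot_mono' _ ?_ hlin')
  · filter_upwards [Filter.eventually_ge_atTop 0] with t ht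
    have : f 0 - c * 0 ≤ f t - c * t := hm ht
    linarith
  · filter_upwards [Filter.eventually_le_atBot 0] with t ht
    have : f t - c * t ≤ f 0 - c * 0 := hm ht
    linarith

/-! ### The back-and-forth construction -/

/-- The requirements on a correction polynomial `r` and a finite set `S` of points at which
`g + r` has reached its final value. -/
structure ApproxInvariant (g g' : ℝ → ℝ) (x y : ℝ) (n : ℕ) (r : ℝ[X]) (S : Finset ℝ) : Prop where
  -- Step n may spend a further (1/2)^(n+2) of g', so the total stays below one half and g + r keeps
  -- slope at least g'/2.
  deriv_le : ∀ t, |(derivative r).eval t| ≤ (1 / 2 - (1 / 2) ^ (n + 1)) * g' t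
  mem : x ∈ S
  eval_eq : g x + r.eval x = y
  rat : ∀ p ∈ S, p ≠ x → ∃ a : ℚ, g p + r.eval p = p + a

/-- The task `(u, true)` asks for `u ∈ S`, the task `(v, false)` asks that `g + r` takes the
value `v` on `S`. -/
def TaskDone (g : ℝ → ℝ) (r : ℝ[X]) (S : Finset ℝ) (τ : ℝ × Bool) : Prop :=
  (τ.2 = true → τ.1 ∈ S) ∧ (τ.2 = false → ∃ p ∈ S, g p + r.eval p = τ.1)

/-- One approximation step fulfils a task by a tiny change of `r` that vanishes on `S`. -/
structure ApproxStep (M : ℕ → ℝ) (g g' : ℝ → ℝ) (n : ℕ) (τ : ℝ × Bool) (r : ℝ[X]) (S : Finset ℝ)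
    (r₁ : ℝ[X]) (S₁ : Finset ℝ) : Prop where
  tiny : (r₁ - r).IsTiny M n
  deriv_le : ∀ t, |(derivative (r₁ - r)).eval t| ≤ (1 / 2) ^ (n + 2) * g' t
  subset : S ⊆ S₁
  eval_eq : ∀ p ∈ S, r₁.eval p = r.eval p
  done : TaskDone g r₁ S₁ τ

/-- A small multiple of `h` takes `f` at `u` to a rational translate of `u`. -/
theorem exists_small_rat_value {ε h : ℝ} (hε : 0 < ε) (hh : h ≠ 0) (f u : ℝ) :
    ∃ l, |l| ≤ ε ∧ ∃ a : ℚ, f + l * h = u + a := by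
  have hh' : 0 < |h| := abs_pos.2 hh
  obtain ⟨a, ha1, ha2⟩ := exists_rat_btwn (show f - u < f - u + ε * |h| by
    have := mul_pos hε hh'; linarith)
  refine ⟨(u + a - f) / h, ?_, a, by field_simp; ring⟩
  rw [abs_div, div_le_iff₀ hh', abs_le]
  constructor <;> linarith [mul_pos hε hh']

/-- A small multiple of `h` makes `f` take the value `v` at a rational translate of `v`. -/
theorem exists_small_rat_preimage {ε : ℝ} (hε : 0 < ε) {f h : ℝ → ℝ} (hf : Continuous f)
    (hh : Continuous h) {w₀ v : ℝ} (hw : f w₀ = v) (hw₀ : h w₀ ≠ 0) :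
    ∃ l, |l| ≤ ε ∧ ∃ w, f w + l * h w = v ∧ ∃ a : ℚ, v = w + a := by
  -- The multiple of h needed to hit v at w depends continuously on w and vanishes at w₀; hence it
  -- is small at a nearby w with v - w rational.
  have hc : ContinuousAt (fun w ↦ (v - f w) / h w) w₀ :=
    (continuousAt_const.sub hf.continuousAt).div hh.continuousAt hw₀
  have h1 : ∀ᶠ w in nhds w₀, |(v - f w) / h w| < ε := by
    refine hc.abs.eventually_lt continuousAt_const ?_
    simpa [hw] using hε
  obtain ⟨δ, hδ, hb⟩ := Metric.eventually_nhds_iff.1 (h1.and (hh.continuousAt.eventually_ne hw₀))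
  obtain ⟨a, ha1, ha2⟩ := exists_rat_btwn (show v - w₀ < v - w₀ + δ by linarith)
  obtain ⟨h2, h3⟩ := hb (y := v - a) (by rw [Real.dist_eq, abs_lt]; constructor <;> linarith)
  exact ⟨_, h2.le, v - a, by field_simp; ring, a, by ring⟩

section Construction

variable {M : ℕ → ℝ} {g g' : ℝ → ℝ} {x y c : ℝ}

theorem ApproxInvariant.strictMono_surjective {n : ℕ} {r : ℝ[X]} {S : Finset ℝ}
    (hg : ∀ t, HasDerivAt g (g' t) t) (hc : 0 < c) (hcg : ∀ t, c ≤ g' t)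
    (hI : ApproxInvariant g g' x y n r S) :
    StrictMono (fun t ↦ g t + r.eval t) ∧ Function.Surjective (fun t ↦ g t + r.eval t) := by
  refine strictMono_surjective_of_deriv_ge (half_pos hc)
    (fun t ↦ (hg t).fun_add (r.hasDerivAt t)) fun t ↦ ?_
  have h1 := (abs_le.1 (hI.deriv_le t)).1
  have h2 : 0 ≤ (1 / 2 : ℝ) ^ (n + 1) * g' t :=
    mul_nonneg (by positivity) (hc.le.trans (hcg t))
  linarith [hcg t]

theorem ApproxInvariant.exists_step (hM : ∀ k, 0 < M k)
    (hg : ∀ t, HasDerivAt g (g' t) t) (hc : 0 < c) (hcg : ∀ t, c ≤ g' t)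
    (hdom : ∀ p : ℝ[X], ∃ K > 0, ∀ t, |p.eval t| ≤ K * g' t) {n : ℕ} {r : ℝ[X]} {S : Finset ℝ}
    (hI : ApproxInvariant g g' x y n r S) (τ : ℝ × Bool) :
    ∃ r₁ S₁, ApproxInvariant g g' x y (n + 1) r₁ S₁ ∧ ApproxStep M g g' n τ r S r₁ S₁ := by
  classical
  -- Multiples of h leave the values on S alone and can move the value at any other point.
  set h : ℝ[X] := ∏ p ∈ S, (X - C p) with hh
  have hroot (t : ℝ) : h.eval t = 0 ↔ t ∈ S := by
    simp [hh, eval_prod, Finset.prod_eq_zero_iff, sub_eq_zero]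
  obtain ⟨ε₁, hε₁, htiny⟩ := exists_isTiny hM n h
  obtain ⟨K, hK, hKd⟩ := hdom (derivative h)
  obtain ⟨ε, hε, hεl, hεr⟩ : ∃ ε > 0, ε ≤ ε₁ ∧ ε ≤ (1 / 2) ^ (n + 2) / K :=
    ⟨min ε₁ ((1 / 2) ^ (n + 2) / K), by positivity, min_le_left _ _, min_le_right _ _⟩
  have hcont : Continuous fun t ↦ g t + r.eval t :=
    (continuous_iff_continuousAt.2 fun t ↦ (hg t).continuousAt).add r.continuous
  obtain ⟨l, hl, S₁, hsub, hrat, hdone⟩ : ∃ l, |l| ≤ ε ∧ ∃ S₁, S ⊆ S₁ ∧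
      (∀ p ∈ S₁, p ∉ S → ∃ a : ℚ, g p + (r + C l * h).eval p = p + a) ∧
      TaskDone g (r + C l * h) S₁ τ := by
    obtain ⟨u, b⟩ := τ
    cases b with
    | true =>
      by_cases hu : u ∈ S
      · exact ⟨0, by simpa using hε.le, S, subset_rfl, fun p h1 h2 ↦ absurd h1 h2, by simpa
          [TaskDone] using hu⟩
      · obtain ⟨l, hl, a, ha⟩ := exists_small_rat_value hε (mt (hroot u).1 hu) (g u + r.eval u) u
        refine ⟨l, hl, insert u S, Finset.subset_insert _ _, fun p hp hpS ↦ ⟨a, ?_⟩,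
          by simp [TaskDone]⟩
        obtain rfl := (Finset.mem_insert.1 hp).resolve_right hpS
        simpa [add_assoc] using ha
    | false =>
      obtain ⟨w₀, hw₀⟩ := (hI.strictMono_surjective hg hc hcg).2 u
      by_cases hw : w₀ ∈ S
      · exact ⟨0, by simpa using hε.le, S, subset_rfl, fun p h1 h2 ↦ absurd h1 h2, by
          simpa [TaskDone] using ⟨w₀, hw, hw₀⟩⟩
      · obtain ⟨l, hl, w, hwv, a, ha⟩ := exists_small_rat_preimage hε hcont h.continuous hw₀
          (mt (hroot w₀).1 hw)
        have hv : g w + (r + C l * h).eval w = u := by simpa [add_assoc] using hwv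
        refine ⟨l, hl, insert w S, Finset.subset_insert _ _, fun p hp hpS ↦ ⟨a, ?_⟩,
          by simp, fun _ ↦ ⟨w, Finset.mem_insert_self _ _, hv⟩⟩
        obtain rfl := (Finset.mem_insert.1 hp).resolve_right hpS
        rw [hv, ha]
  have heval (p : ℝ) (hp : p ∈ S) : (r + C l * h).eval p = r.eval p := by
    simp [(hroot p).2 hp]
  have hd (t : ℝ) : |(derivative (C l * h)).eval t| ≤ (1 / 2) ^ (n + 2) * g' t := by
    rw [derivative_C_mul, eval_C_mul, abs_mul]
    calc |l| * |(derivative h).eval t| ≤ (1 / 2) ^ (n + 2) / K * (K * g' t) := by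
          gcongr
          · exact hl.trans hεr
          · exact hKd t
      _ = _ := by field_simp
  refine ⟨r + C l * h, S₁, ⟨fun t ↦ ?_, hsub hI.mem, ?_, fun p hp hpx ↦ ?_⟩, ⟨?_, ?_, hsub, heval,
    hdone⟩⟩
  · rw [derivative_add, eval_add]
    refine (abs_add_le _ _).trans ((add_le_add (hI.deriv_le t) (hd t)).trans (le_of_eq ?_))
    ring
  · rw [heval x hI.mem, hI.eval_eq]
  · by_cases hpS : p ∈ S
    · rw [heval p hpS]; exact hI.rat p hpS hpx
    · exact hrat p hp hpS
  · rw [add_sub_cancel_left]; exact htiny l (hl.trans hεl)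
  · rw [add_sub_cancel_left]; exact hd

theorem ApproxInvariant.zero : ApproxInvariant g g' x y 0 (C (y - g x)) {x} :=
  ⟨by simp, by simp, by simp, by simp⟩

theorem exists_approx_sequence (hM : ∀ k, 0 < M k)
    (hg : ∀ t, HasDerivAt g (g' t) t) (hc : 0 < c) (hcg : ∀ t, c ≤ g' t)
    (hdom : ∀ p : ℝ[X], ∃ K > 0, ∀ t, |p.eval t| ≤ K * g' t) (x y : ℝ) (τ : ℕ → ℝ × Bool) :
    ∃ (r : ℕ → ℝ[X]) (S : ℕ → Finset ℝ), r 0 = C (y - g x) ∧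
      ∀ n, ApproxInvariant g g' x y n (r n) (S n) ∧
        ApproxStep M g g' n (τ n) (r n) (S n) (r (n + 1)) (S (n + 1)) := by
  choose! R T hI hS using fun (n : ℕ) (r : ℝ[X]) (S : Finset ℝ)
    (h : ApproxInvariant g g' x y n r S) ↦ h.exists_step hM hg hc hcg hdom (τ n)
  let s : ℕ → ℝ[X] × Finset ℝ :=
    Nat.rec (C (y - g x), {x}) fun n p ↦ (R n p.1 p.2, T n p.1 p.2)
  have hs (n : ℕ) : ApproxInvariant g g' x y n (s n).1 (s n).2 := by
    induction n with
    | zero => exact .zero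
    | succ n ih => exact hI n _ _ ih
  exact ⟨fun n ↦ (s n).1, fun n ↦ (s n).2, rfl, fun n ↦ ⟨hs n, hS n _ _ (hs n)⟩⟩

end Construction

/-- For a countable set `U` of reals, `C_loc {M_k}` has an increasing bijection through a given
point `(x, y)` that otherwise moves the members of `U`, and its inverse those of `U`, by rational
amounts. -/
theorem exists_orderIso_mem_CLoc {M : ℕ → ℝ} (hM : ∀ k, 0 < M k) {U : Set ℝ} (hU : U.Countable)
    (x y : ℝ) :
    ∃ F : ℝ ≃o ℝ, (F : ℝ → ℝ) ∈ CLoc M ∧ F x = y ∧ (∀ u ∈ U, u ≠ x → ∃ a : ℚ, F u = u + a) ∧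
      ∀ v ∈ U, v ≠ y → ∃ a : ℚ, F.symm v = v + a := by
  obtain ⟨g, hgM, g', hg, ⟨c, hc, hcg⟩, hdom⟩ := exists_mem_CLoc_dominating hM
  -- The point 0 is adjoined only to make the set of tasks nonempty, hence enumerable by ℕ.
  obtain ⟨τ, hτ⟩ : ∃ τ : ℕ → ℝ × Bool, insert 0 U ×ˢ Set.univ = Set.range τ :=
    ((hU.insert 0).prod (Set.to_countable _)).exists_eq_range ⟨(0, true), by simp⟩
  obtain ⟨r, S, hr0, hrS⟩ := exists_approx_sequence hM hg hc hcg hdom x y τ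
  set q : ℕ → ℝ[X] := fun n ↦ r (n + 1) - r n with hq
  have hqt (n : ℕ) : (q n).IsTiny M n := (hrS n).2.tiny
  set f : ℝ → ℝ := fun t ↦ g t + (r 0).eval t + ∑' n, (q n).eval t with hf
  have hfM : f ∈ CLoc M :=
    CLoc.add hM (CLoc.add hM hgM (eval_mem_CLoc hM (r 0))) (tsum_eval_mem_CLoc hM hqt)
  have hfd (t : ℝ) : HasDerivAt f (g' t + 0 + ∑' n, (derivative (q n)).eval t) t := by
    refine ((hg t).fun_add ?_).fun_add (hasDerivAt_tsum_eval hM hqt 0 t)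
    simpa [hr0] using hasDerivAt_const t (y - g x)
  have hfd' (t : ℝ) : c / 2 ≤ g' t + 0 + ∑' n, (derivative (q n)).eval t := by
    have h1 : HasSum (fun n : ℕ ↦ (1 / 2 : ℝ) ^ (n + 2) * g' t) (1 / 2 * g' t) := by
      have := hasSum_geometric_two.mul_left (1 / 4 * g' t)
      rw [show 1 / 4 * g' t * 2 = 1 / 2 * g' t by ring] at this
      exact (funext fun n ↦ by ring :
        (fun n : ℕ ↦ (1 / 2 : ℝ) ^ (n + 2) * g' t) = fun n ↦ 1 / 4 * g' t * (1 / 2) ^ n) ▸ this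
    have h2 := tsum_of_norm_bounded (f := fun n ↦ (derivative (q n)).eval t) h1
      fun n ↦ (hrS n).2.deriv_le t
    have h3 := (abs_le.1 h2).1
    linarith [hcg t]
  have hstable (n m : ℕ) (hnm : n ≤ m) : S n ⊆ S m ∧ ∀ p ∈ S n, (r m).eval p = (r n).eval p := by
    induction m, hnm using Nat.le_induction with
    | base => exact ⟨subset_rfl, fun _ _ ↦ rfl⟩
    | succ m _ ih =>
      exact ⟨ih.1.trans (hrS m).2.subset, fun p hp ↦
        ((hrS m).2.eval_eq p (ih.1 hp)).trans (ih.2 p hp)⟩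
  have hfS (n : ℕ) (p : ℝ) (hp : p ∈ S n) : f p = g p + (r n).eval p := by
    -- The partial sums telescope and are constant from index n on, as later corrections vanish on S
    -- n.
    have h1 := (summable_eval_iterate_derivative hM hqt 0 p).hasSum.tendsto_sum_nat
    have h2 : Filter.Tendsto (fun m ↦ ∑ i ∈ Finset.range m, (q i).eval p) Filter.atTop
        (nhds ((r n).eval p - (r 0).eval p)) := by
      refine tendsto_const_nhds.congr' ?_
      filter_upwards [Filter.eventually_ge_atTop n] with m hm
      simp only [hq, eval_sub]
      rw [Finset.sum_range_sub (fun i ↦ (r i).eval p), (hstable n m hm).2 p hp]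
    have h3 : ∑' i, (q i).eval p = (r n).eval p - (r 0).eval p := tendsto_nhds_unique h1 h2
    simp only [hf]
    rw [h3]
    ring
  obtain ⟨hmono, hsurj⟩ := strictMono_surjective_of_deriv_ge (half_pos hc) hfd hfd'
  have hfx : f x = y := (hfS 0 x (hrS 0).1.mem).trans (hrS 0).1.eval_eq
  have hrat (n : ℕ) (p : ℝ) (hp : p ∈ S n) (hpx : p ≠ x) : ∃ a : ℚ, f p = p + a := by
    rw [hfS n p hp]; exact (hrS n).1.rat p hp hpx
  have htask (u : ℝ) (hu : u ∈ U) (b : Bool) : ∃ n, τ n = (u, b) := by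
    rw [← Set.mem_range, ← hτ]
    exact ⟨Or.inr hu, trivial⟩
  refine ⟨hmono.orderIsoOfSurjective f hsurj, hfM, hfx, fun u hu hux ↦ ?_, fun v hv hvy ↦ ?_⟩
  · obtain ⟨n, hn⟩ := htask u hu true
    exact hrat (n + 1) u (by simpa [hn] using (hrS n).2.done.1) hux
  · obtain ⟨n, hn⟩ := htask v hv false
    obtain ⟨p, hp, hpv⟩ := (hrS n).2.done.2 (by rw [hn])
    rw [← hfS _ p hp, hn] at hpv
    -- The point x is exempt from the rationality requirement, but its value is y, so it is not the
    -- preimage of v.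
    have hpx : p ≠ x := fun e ↦ hvy (by rw [← hfx, ← e, hpv])
    obtain ⟨a, ha⟩ := hrat _ p hp hpx
    refine ⟨-a, ?_⟩
    rw [OrderIso.symm_apply_eq]
    have e : v + ((-a : ℚ) : ℝ) = p := by
      have : p + a = v := ha.symm.trans hpv
      push_cast; linarith
    rw [e]
    exact hpv.symm

/-! ### Sparse systems from CH -/

open Cardinal in
/-- Under the Continuum Hypothesis, countable sets of reals can be attached to the points of the
plane so that every real belongs to all but countably many of them. -/
theorem ContinuumHypothesis.exists_countable_cover (h : ContinuumHypothesis) :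
    ∃ U : ℝ × ℝ → Set ℝ, (∀ P, (U P).Countable) ∧ ∀ u, {P | u ∉ U P}.Countable := by
  have hc : continuum.{0} = aleph 1 := h
  have hT : #(aleph.{0} 1).ord.ToType = aleph 1 := mk_ord_toType _
  obtain ⟨j⟩ : Nonempty (ℝ ≃ (aleph.{0} 1).ord.ToType) := by
    rw [← Cardinal.eq, hT, mk_real, hc]
  obtain ⟨e⟩ : Nonempty (ℝ × ℝ ≃ (aleph.{0} 1).ord.ToType) := by
    rw [← Cardinal.eq, hT, mk_prod, mk_real]
    simpa using hc
  have hI (a : (aleph.{0} 1).ord.ToType) : (Set.Iio a).Countable := by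
    have h1 : #(Set.Iio a) < aleph 1 := by
      have := mk_Iio_lt a (by rw [hT, Ordinal.type_toType])
      rwa [hT] at this
    exact le_aleph0_iff_set_countable.1 (Order.lt_succ_iff.1 (h1.trans_eq succ_aleph0.symm))
  -- With line and plane both indexed by ω₁, u belongs to U P when its index is at most that of P;
  -- initial segments of ω₁ are countable in either direction of use.
  refine ⟨fun P ↦ j ⁻¹' Set.Iic (e P), fun P ↦ ?_, fun u ↦ ?_⟩
  · refine Set.Countable.preimage ?_ j.injective
    rw [← Set.Iio_insert]
    exact (hI _).insert _
  · exact ((hI (j u)).preimage e.injective).mono fun P hP ↦ lt_of_not_ge (α := (aleph.{0} 1).ord.ToType) hP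

/-- The values at u lie in u + ℚ, apart from those of the countably many P with u ∉ U P. -/
theorem carriesSparseSystem_of_continuumHypothesis (h : ContinuumHypothesis) {M : ℕ → ℝ}
    (hM : ∀ k, 0 < M k) : CarriesSparseSystem (CLoc M) := by
  obtain ⟨U, hUc, hco⟩ := h.exists_countable_cover
  choose F hFM hFx hF hFs using fun P : ℝ × ℝ ↦ exists_orderIso_mem_CLoc hM (hUc P) P.1 P.2
  refine ⟨F, hFM, hFx, fun u ↦ ?_, fun u ↦ ?_⟩
  · refine (((hco u).image fun P ↦ F P u).union
      (Set.countable_range fun a : ℚ ↦ u + (a : ℝ))).mono ?_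
    rintro _ ⟨P, hP, rfl⟩
    by_cases hu : u ∈ U P
    · obtain ⟨a, ha⟩ := hF P u hu hP
      exact Or.inr ⟨a, ha.symm⟩
    · exact Or.inl ⟨P, hu, rfl⟩
  · refine (((hco u).image fun P ↦ (F P).symm u).union
      (Set.countable_range fun a : ℚ ↦ u + (a : ℝ))).mono ?_
    rintro _ ⟨P, hP, rfl⟩
    by_cases hu : u ∈ U P
    · obtain ⟨a, ha⟩ := hFs P u hu hP
      exact Or.inr ⟨a, ha.symm⟩
    · exact Or.inl ⟨P, hu, rfl⟩

theorem theorem3 :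
    (IsQuasiAnalytic (CLoc (fun k => (Nat.factorial k : ℝ))) ∧
      CLoc (fun k => (Nat.factorial k : ℝ)) = {f : ℝ → ℝ | AnalyticOnNhd ℝ f Set.univ}) ∧
    List.TFAE
      [ContinuumHypothesis,
       ∀ Γ : Set (ℝ → ℝ), IsLocallyDenjoyCarleman Γ → CarriesSparseSystem Γ,
       ∃ Γ : Set (ℝ → ℝ), IsLocallyDenjoyCarleman Γ ∧ IsQuasiAnalytic Γ ∧ CarriesSparseSystem Γ,
       CarriesSparseSystem (CLoc (fun k => (Nat.factorial k : ℝ)))] := by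
  have hpos (k : ℕ) : (0 : ℝ) < k.factorial := by positivity
  refine ⟨⟨isQuasiAnalytic_CLoc_factorial, CLoc_factorial_eq⟩, ?_⟩
  tfae_have 1 → 2 := by
    rintro h Γ ⟨M, hM, rfl⟩
    exact carriesSparseSystem_of_continuumHypothesis h hM
  tfae_have 2 → 4 := fun h ↦ h _ ⟨_, hpos, rfl⟩
  tfae_have 4 → 3 := fun h ↦ ⟨_, ⟨_, hpos, rfl⟩, isQuasiAnalytic_CLoc_factorial, h⟩
  tfae_have 3 → 1 := by
    rintro ⟨Γ, ⟨M, hM, rfl⟩, hq, hs⟩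
    exact continuumHypothesis_of_carriesSparseSystem hM hq hs
  tfae_finish
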